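/- A *mesh pattern* of length $k$ is a pair $(\tau,R)$ with $\tau$ a permutation of $\{1,\dots,k\}$ and $R\subseteq\{0,\dots,k\}^2$ a set of shaded boxes. An *occurrence* of $(\tau,R)$ in a permutation $\pi=\pi_1\cdots\pi_n$ of $\{1,\dots,n\}$ is a choice of positions $i_1<\cdots<i_k$ such that $\pi_{i_1}\cdots\pi_{i_k}$ is order-isomorphic to $\tau$ and, for every $(a,b)\in R$, there is no position $l$ with $i_a<l<i_{a+1}$ and $v_b<\pi_l<v_{b+1}$, where $v_1<\cdots<v_k$ are the values $\pi_{i_1},\dots,\pi_{i_k}$ in increasing order, $i_0=v_0=0$ and $i_{k+1}=v_{k+1}=n+1$. A permutation *avoids* the pattern if it has no occurrence of it. Two patterns are *Wilf-equivalent* if for every $n\ge 0$ they are avoided by the same number of permutations of $\{1,\dots,n\}$. Let $R=\{(0,1),(0,2),(1,0),(2,0)\}$, $q_1=(123,R)$ and $q_2=(132,R)$. Then $q_1$ and $q_2$ are Wilf-equivalent. Moreover, for every $n\ge 0$ the following procedure defines a bijection $g$ from the $q_1$-avoiding permutations of $\{1,\dots,n\}$ onto the $q_2$-avoiding ones. Start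 with a $q_1$-avoiding permutation $\pi$. As long as the current permutation contains an occurrence of $q_2$, take the leftmost one (the one whose triple of positions $(i_1,i_2,i_3)$ is lexicographically smallest) and swap the entries in positions $i_2$ and $i_3$. The procedure terminates, and $g(\pi)$ is the $q_2$-avoiding permutation at which it stops. -/

import Mathlib

/-- A mesh pattern of length `k`: a permutation `perm` of length `k` (its diagram has a dot in
column `i` at height `perm i`) together with a set of shaded boxes. The box `(a, b)` is the one
in the `a`-th column and `b`-th row, both counted from `0`, of the `(k + 1) × (k + 1)` boxes into
which the grid lines through the dots cut the plane; `(0, 0)` is at the bottom left. -/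
structure MeshPattern (k : ℕ) where
  perm : Equiv.Perm (Fin k)
  shaded : Set (Fin (k + 1) × Fin (k + 1))

namespace MeshPattern

variable {k n : ℕ}

/-- Given positions `e 0 < ⋯ < e (k - 1)` in `π` at which the values are ordered as in `p`,
the dot of `π` at position `l` lies in the (open) box `box` of the grid spanned by these `k` dots:
exactly the first `box.1` of the dots are to its left, exactly the lowest `box.2` of the dots are
below it, and it is none of these dots. -/
def InBox (p : MeshPattern k) (π : Equiv.Perm (Fin n)) (e : Fin k → Fin n)
    (box : Fin (k + 1) × Fin (k + 1)) (l : Fin n) : Prop :=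
  (∀ i : Fin k, if i.val < box.1.val then e i < l else l < e i) ∧
  (∀ i : Fin k, if (p.perm i).val < box.2.val then π (e i) < π l else π l < π (e i))

/-- The positions `e 0 < ⋯ < e (k - 1)` of the permutation `π` form an occurrence of `p`. -/
def IsOccurrence (p : MeshPattern k) (π : Equiv.Perm (Fin n)) (e : Fin k → Fin n) : Prop :=
  StrictMono e ∧
  (∀ i j : Fin k, π (e i) < π (e j) ↔ p.perm i < p.perm j) ∧
  (∀ box ∈ p.shaded, ∀ l : Fin n, ¬ p.InBox π e box l)

/-- The permutation `π` avoids `p`. -/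
def Avoids (p : MeshPattern k) (π : Equiv.Perm (Fin n)) : Prop :=
  ∀ e : Fin k → Fin n, ¬ p.IsOccurrence π e

/-- For every `n ≥ 0` the two patterns are avoided by equally many `n`-permutations. -/
def WilfEquivalent {k l : ℕ} (p : MeshPattern k) (q : MeshPattern l) : Prop :=
  ∀ n : ℕ, Nat.card {π : Equiv.Perm (Fin n) // p.Avoids π} =
    Nat.card {π : Equiv.Perm (Fin n) // q.Avoids π}

/-- The leftmost occurrence: its tuple of positions is lexicographically smallest. -/
def IsLeftmostOccurrence (p : MeshPattern k) (π : Equiv.Perm (Fin n)) (e : Fin k → Fin n) :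
    Prop :=
  p.IsOccurrence π e ∧ ∀ f : Fin k → Fin n, p.IsOccurrence π f → toLex e ≤ toLex f

/-- The pattern `123` with the boxes `(0, 1)`, `(0, 2)`, `(1, 0)`, `(2, 0)` shaded. -/
def q₁ : MeshPattern 3 where
  perm := 1
  shaded := {(0, 1), (0, 2), (1, 0), (2, 0)}

/-- The pattern `132` with the boxes `(0, 1)`, `(0, 2)`, `(1, 0)`, `(2, 0)` shaded. -/
def q₂ : MeshPattern 3 where
  perm := Equiv.swap 1 2
  shaded := {(0, 1), (0, 2), (1, 0), (2, 0)}

/-- `σ` arises from `π` by swapping the second and the third element of the leftmost occurrence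
of `q₂` in `π`. (There is no such `σ` if `π` avoids `q₂`, and exactly one otherwise.) -/
def SwapStep (π σ : Equiv.Perm (Fin n)) : Prop :=
  ∃ e : Fin 3 → Fin n, q₂.IsLeftmostOccurrence π e ∧ σ = π * Equiv.swap (e 1) (e 2)

end MeshPattern

/-!
An occurrence of `q₁` or of `q₂` at positions `i < j < k` of `π` says that the dots at `j` and `k`
both lie in one region attached to the dot at `i`: to its right and above it, before the next
entry below `π i`, and below all larger entries that precede `i`. Write `Under π i l` when the
dot at `l` lies in the region of `i`. Then `π` avoids `q₁` exactly when its entries decrease along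
each region, and avoids `q₂` exactly when they increase along each region.

The regions form a laminar family: `Under π` is transitive, and two positions above the same one
are comparable. So it suffices to look at the regions of the *roots*, the positions under no other
one; these regions are pairwise disjoint and contain every position that is not a root. Swapping
two entries in the region of a root changes neither the roots and their values, nor which
positions lie under which root, nor the set of values in each of these regions
(`SameShape.mul_swap`). A permutation is determined by these data together with the order of the
entries in each region, so among the permutations of one shape at most one avoids `q₁` and at most
one avoids `q₂`.

The leftmost occurrence of `q₂` starts at a root, since otherwise its first position could be
replaced by one further left. Hence a step of the procedure preserves the shape; it also makes the
word of `π` lexicographically smaller, so the procedure stops, at the `q₂`-avoider of the shape.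
Dually, a lexicographically largest permutation of a given shape avoids `q₁`. So every shape has
exactly one avoider of each kind, and the procedure sends one to the other.
-/

namespace MeshPattern

variable {n : ℕ}

/-! ### The region of a dot -/

/-- The dot of `π` at position `l` lies in the region of the dot at `i`: it is to the right of and
above that dot, no entry at a position strictly between `i` and `l` is smaller than `π i`, and no
entry before position `i` has a value strictly between `π i` and `π l`. -/
def Under (π : Equiv.Perm (Fin n)) (i l : Fin n) : Prop :=
  i < l ∧ π i < π l ∧ (∀ m, i < m → m < l → π i < π m) ∧
    ∀ m, m < i → π i < π m → π l < π m

/-- The position `i` lies in the region of no other position. -/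
def IsRoot (π : Equiv.Perm (Fin n)) (i : Fin n) : Prop := ∀ m, ¬ Under π m i

theorem not_under_self (π : Equiv.Perm (Fin n)) (i : Fin n) : ¬ Under π i i :=
  fun h => lt_irrefl _ h.1

theorem Under.trans {π : Equiv.Perm (Fin n)} {i j l : Fin n} (h : Under π i j)
    (h' : Under π j l) : Under π i l := by
  obtain ⟨h1, h2, h3, h4⟩ := h
  obtain ⟨k1, k2, k3, k4⟩ := h'
  refine ⟨h1.trans k1, h2.trans k2, fun m hm hml => ?_, fun m hm hlt => ?_⟩
  · rcases lt_trichotomy m j with hj | rfl | hj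
    · exact h3 m hm hj
    · exact h2
    · exact h2.trans (k3 m hj hml)
  · exact k4 m (hm.trans h1) (h4 m hm hlt)

/-- Together with `Under.trans`, this says that two regions are nested or disjoint. -/
theorem Under.under_of_lt {π : Equiv.Perm (Fin n)} {i j l : Fin n} (hi : Under π i l)
    (hj : Under π j l) (hij : i < j) : Under π i j :=
  ⟨hij, hi.2.2.1 j hij hj.1, fun m hm hmj => hi.2.2.1 m hm (hmj.trans hj.1),
    fun m hm hlt => hj.2.1.trans (hi.2.2.2 m hm hlt)⟩

theorem IsRoot.eq_of_under {π : Equiv.Perm (Fin n)} {i j l : Fin n} (hi : IsRoot π i)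
    (hj : IsRoot π j) (hil : Under π i l) (hjl : Under π j l) : i = j := by
  rcases lt_trichotomy i j with h | h | h
  · exact absurd (hil.under_of_lt hjl h) (hj i)
  · exact h
  · exact absurd (hjl.under_of_lt hil h) (hi j)

theorem isRoot_or_exists_under (π : Equiv.Perm (Fin n)) (l : Fin n) :
    IsRoot π l ∨ ∃ i, IsRoot π i ∧ Under π i l := by
  induction l using WellFoundedLT.induction with
  | ind l ih =>
    by_cases h : IsRoot π l
    · exact Or.inl h
    · simp only [IsRoot, not_forall, not_not] at h
      obtain ⟨m, hm⟩ := h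
      rcases ih m hm.1 with hr | ⟨i, hr, hi⟩
      · exact Or.inr ⟨m, hr, hm⟩
      · exact Or.inr ⟨i, hr, hi.trans hm⟩

/-! ### Swapping two entries in the region of a root -/

/-- Swapping two entries in the region of a root `i` does not affect the region of any position
`m` outside it (`m = i` included). -/
theorem under_mul_swap_iff {π : Equiv.Perm (Fin n)} {i j k : Fin n} (hi : IsRoot π i)
    (hj : Under π i j) (hk : Under π i k) {m : Fin n} (hm : ¬ Under π i m) (l : Fin n) :
    Under (π * Equiv.swap j k) m l ↔ Under π m l := by
  have e1 : (π * Equiv.swap j k) j = π k := by simp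
  have e2 : (π * Equiv.swap j k) k = π j := by simp
  have e3 : ∀ x, x ≠ j → x ≠ k → (π * Equiv.swap j k) x = π x := fun x h h' => by
    simp [Equiv.swap_apply_of_ne_of_ne h h']
  generalize π * Equiv.swap j k = σ at *
  have hmj : m ≠ j := by rintro rfl; exact hm hj
  have hmk : m ≠ k := by rintro rfl; exact hm hk
  have em := e3 m hmj hmk
  have hji := hj.1
  have hki := hk.1
  have hj2 := hj.2.1
  have hk2 := hk.2.1
  have hj4 := hj.2.2.2
  have hk4 := hk.2.2.2
  rcases lt_trichotomy m i with hlt | rfl | hgt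
  -- If a position `l` beyond the root `i` holds a value `v > π i`, then it cannot lie in the region
  -- of `m < i`, before or after the swap: `i` itself would lie there.
  · have key : ∀ v, i < l → π i < v → (π m < π i) → (∀ x, m < x → x < l → x ≠ j → x ≠ k → π m < π x) →
        (∀ x, x < m → π m < π x → v < π x) → False := by
      intro v hl hv h0 h1 h2
      refine hi m ⟨hlt, h0, fun x hx hxi => ?_, fun x hx hxm => ?_⟩
      · exact h1 x hx (hxi.trans hl) (by omega) (by omega)
      · exact hv.trans (h2 x hx hxm)
    have e4 : ∀ x, x ≤ i → σ x = π x := fun x hx => e3 x (by omega) (by omega)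
    unfold Under
    grind
  · unfold Under
    grind
  -- Either an entry below `π i` occurs after `i` and not after `m`, and then `j` and `k` are to the
  -- left of `m`; or an entry before `i` separates `π m` from the smaller values at `j` and `k`.
  · by_cases hc : ∃ x, i < x ∧ x ≤ m ∧ π x < π i
    · obtain ⟨x, hx, hxm, hxi⟩ := hc
      have h1 : j < x := by
        by_contra h
        rcases eq_or_lt_of_le (not_lt.1 h) with rfl | h
        · exact lt_asymm hxi hj2
        · exact lt_asymm hxi (hj.2.2.1 x hx h)
      have h2 : k < x := by
        by_contra h
        rcases eq_or_lt_of_le (not_lt.1 h) with rfl | h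
        · exact lt_asymm hxi hk2
        · exact lt_asymm hxi (hk.2.2.1 x hx h)
      unfold Under
      grind
    · push Not at hc
      have him : π i < π m := lt_of_le_of_ne (hc m hgt le_rfl) (π.injective.ne hgt.ne)
      have : ∃ u, u < i ∧ π i < π u ∧ π u ≤ π m := by
        by_contra hu
        push Not at hu
        exact hm ⟨hgt, him, fun x hx hxm => lt_of_le_of_ne (hc x hx hxm.le)
          (π.injective.ne hx.ne), hu⟩
      obtain ⟨u, hu, hiu, hum⟩ := this
      have h1 := hj4 u hu hiu
      have h2 := hk4 u hu hiu
      unfold Under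
      grind

/-- `π` and `σ` have the same roots with the same values, the same positions in the region of each
root, and the same set of values there. -/
structure SameShape (π σ : Equiv.Perm (Fin n)) : Prop where
  isRoot_iff : ∀ i, IsRoot π i ↔ IsRoot σ i
  under_iff : ∀ i, IsRoot π i → ∀ l, Under π i l ↔ Under σ i l
  apply_eq : ∀ i, IsRoot π i → π i = σ i
  image_eq : ∀ i, IsRoot π i → π '' {l | Under π i l} = σ '' {l | Under σ i l}

namespace SameShape

theorem refl (π : Equiv.Perm (Fin n)) : SameShape π π := by
  constructor <;> simp

theorem symm {π σ : Equiv.Perm (Fin n)} (h : SameShape π σ) : SameShape σ π where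
  isRoot_iff i := (h.isRoot_iff i).symm
  under_iff i hi l := (h.under_iff i ((h.isRoot_iff i).2 hi) l).symm
  apply_eq i hi := (h.apply_eq i ((h.isRoot_iff i).2 hi)).symm
  image_eq i hi := (h.image_eq i ((h.isRoot_iff i).2 hi)).symm

theorem trans {π σ τ : Equiv.Perm (Fin n)} (h : SameShape π σ) (h' : SameShape σ τ) :
    SameShape π τ where
  isRoot_iff i := (h.isRoot_iff i).trans (h'.isRoot_iff i)
  under_iff i hi l := (h.under_iff i hi l).trans (h'.under_iff i ((h.isRoot_iff i).1 hi) l)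
  apply_eq i hi := (h.apply_eq i hi).trans (h'.apply_eq i ((h.isRoot_iff i).1 hi))
  image_eq i hi := (h.image_eq i hi).trans (h'.image_eq i ((h.isRoot_iff i).1 hi))

theorem eq_of_eqOn {π σ : Equiv.Perm (Fin n)} (h : SameShape π σ)
    (hb : ∀ i, IsRoot π i → Set.EqOn π σ {l | Under π i l}) : π = σ := by
  ext1 l
  rcases isRoot_or_exists_under π l with hl | ⟨i, hi, hil⟩
  · exact h.apply_eq l hl
  · exact hb i hi hil

theorem mul_swap {π : Equiv.Perm (Fin n)} {i j k : Fin n} (hi : IsRoot π i)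
    (hj : Under π i j) (hk : Under π i k) : SameShape π (π * Equiv.swap j k) := by
  have hU := fun {m} hm l => under_mul_swap_iff hi hj hk (m := m) hm l
  have hii := hU (not_under_self π i)
  have hroot : ∀ m, IsRoot π m ↔ IsRoot (π * Equiv.swap j k) m := by
    intro m
    by_cases hm : Under π i m
    · exact iff_of_false (fun h => h i hm) fun h => h i ((hii m).2 hm)
    · refine forall_congr' fun x => not_congr ?_
      by_cases hx : Under π i x
      · exact iff_of_false (fun h => hm (hx.trans h))
          fun h => hm ((hii m).1 (((hii x).2 hx).trans h))
      · exact (hU hx m).symm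
  have hunder : ∀ m, IsRoot π m → ∀ l, Under (π * Equiv.swap j k) m l ↔ Under π m l :=
    fun m hm => hU (hm i)
  refine ⟨hroot, fun m hm l => (hunder m hm l).symm, fun m hm => ?_, fun m hm => ?_⟩
  · rw [Equiv.Perm.mul_apply, Equiv.swap_apply_of_ne_of_ne]
    · rintro rfl; exact hm i hj
    · rintro rfl; exact hm i hk
  · simp only [hunder m hm]
    have hmem : ∀ l, Under π m (Equiv.swap j k l) ↔ Under π m l := by
      intro l
      have hjk : Under π m j ↔ Under π m k :=
        ⟨fun h => hi.eq_of_under hm hj h ▸ hk, fun h => hi.eq_of_under hm hk h ▸ hj⟩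
      rw [Equiv.swap_apply_def]
      split_ifs with h1 h2
      · rw [h1, hjk]
      · rw [h2, hjk]
      · rfl
    ext v
    constructor
    · rintro ⟨l, hl, rfl⟩
      exact ⟨Equiv.swap j k l, (hmem l).2 hl, by simp⟩
    · rintro ⟨l, hl, rfl⟩
      exact ⟨Equiv.swap j k l, (hmem l).2 hl, by simp⟩

end SameShape

/-! ### Occurrences and avoidance in terms of regions -/

theorem isOccurrence_q₁_iff {π : Equiv.Perm (Fin n)} {e : Fin 3 → Fin n} :
    q₁.IsOccurrence π e ↔
      Under π (e 0) (e 1) ∧ Under π (e 0) (e 2) ∧ e 1 < e 2 ∧ π (e 1) < π (e 2) := by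
  have hinj : ∀ l m, π l = π m → l = m := fun l m h => π.injective h
  simp only [IsOccurrence, InBox, q₁, Under, Fin.strictMono_iff_lt_succ, Fin.forall_fin_succ]
  simp
  constructor
  · rintro ⟨⟨h1, h2⟩, ⟨⟨h3, h4⟩, h5, h6⟩, s1, s2, s3, s4⟩
    grind
  · rintro ⟨⟨h1, h2, h3, h4⟩, ⟨h5, h6, h7, h8⟩, h9, h10⟩
    grind

theorem isOccurrence_q₂_iff {π : Equiv.Perm (Fin n)} {e : Fin 3 → Fin n} :
    q₂.IsOccurrence π e ↔
      Under π (e 0) (e 1) ∧ Under π (e 0) (e 2) ∧ e 1 < e 2 ∧ π (e 2) < π (e 1) := by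
  have hinj : ∀ l m, π l = π m → l = m := fun l m h => π.injective h
  simp only [IsOccurrence, InBox, q₂, Under, Fin.strictMono_iff_lt_succ, Fin.forall_fin_succ]
  simp [Equiv.swap_apply_def]
  constructor
  · rintro ⟨⟨h1, h2⟩, ⟨⟨h3, h4⟩, h5, h6⟩, s1, s2, s3, s4⟩
    grind
  · rintro ⟨⟨h1, h2, h3, h4⟩, ⟨h5, h6, h7, h8⟩, h9, h10⟩
    grind

theorem avoids_q₁_iff {π : Equiv.Perm (Fin n)} :
    q₁.Avoids π ↔ ∀ i, IsRoot π i → StrictAntiOn π {l | Under π i l} := by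
  constructor
  · intro h i _ j hj k hk hjk
    by_contra hc
    refine h ![i, j, k] (isOccurrence_q₁_iff.2 ⟨hj, hk, hjk, ?_⟩)
    exact lt_of_le_of_ne (not_lt.1 hc) (π.injective.ne hjk.ne)
  · intro h e he
    obtain ⟨h1, h2, h3, h4⟩ := isOccurrence_q₁_iff.1 he
    rcases isRoot_or_exists_under π (e 0) with hr | ⟨i, hr, hi⟩
    · exact lt_asymm h4 (h _ hr h1 h2 h3)
    · exact lt_asymm h4 (h _ hr (hi.trans h1) (hi.trans h2) h3)

theorem avoids_q₂_iff {π : Equiv.Perm (Fin n)} :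
    q₂.Avoids π ↔ ∀ i, IsRoot π i → StrictMonoOn π {l | Under π i l} := by
  constructor
  · intro h i _ j hj k hk hjk
    by_contra hc
    refine h ![i, j, k] (isOccurrence_q₂_iff.2 ⟨hj, hk, hjk, ?_⟩)
    exact lt_of_le_of_ne (not_lt.1 hc) (π.injective.ne hjk.ne')
  · intro h e he
    obtain ⟨h1, h2, h3, h4⟩ := isOccurrence_q₂_iff.1 he
    rcases isRoot_or_exists_under π (e 0) with hr | ⟨i, hr, hi⟩
    · exact lt_asymm h4 (h _ hr h1 h2 h3)
    · exact lt_asymm h4 (h _ hr (hi.trans h1) (hi.trans h2) h3)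

/-! ### Uniqueness of the avoiders of a given shape -/

theorem _root_.StrictMonoOn.eqOn_of_image_eq {α β : Type*} [LinearOrder α] [WellFoundedLT α]
    [PartialOrder β] {f g : α → β} {s : Set α} (hf : StrictMonoOn f s) (hg : StrictMonoOn g s)
    (h : f '' s = g '' s) : Set.EqOn f g s := by
  have : s.domRestrict f = s.domRestrict g := by
    rw [← StrictMono.range_inj hf.domRestrict hg.domRestrict, Set.range_domRestrict, Set.range_domRestrict, h]
  exact Set.domRestrict_eq_domRestrict_iff.1 this

theorem SameShape.eq_of_avoids_q₂ {π σ : Equiv.Perm (Fin n)} (h : SameShape π σ)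
    (hπ : q₂.Avoids π) (hσ : q₂.Avoids σ) : π = σ := by
  refine h.eq_of_eqOn fun i hi => ?_
  have hs : {l | Under σ i l} = {l | Under π i l} := Set.ext fun l => (h.under_iff i hi l).symm
  have hσ' := avoids_q₂_iff.1 hσ i ((h.isRoot_iff i).1 hi)
  have him := h.image_eq i hi
  rw [hs] at hσ' him
  exact (avoids_q₂_iff.1 hπ i hi).eqOn_of_image_eq hσ' him

theorem SameShape.eq_of_avoids_q₁ {π σ : Equiv.Perm (Fin n)} (h : SameShape π σ)
    (hπ : q₁.Avoids π) (hσ : q₁.Avoids σ) : π = σ := by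
  refine h.eq_of_eqOn fun i hi => ?_
  have hs : {l | Under σ i l} = {l | Under π i l} := Set.ext fun l => (h.under_iff i hi l).symm
  have hσ' := avoids_q₁_iff.1 hσ i ((h.isRoot_iff i).1 hi)
  have him := h.image_eq i hi
  rw [hs] at hσ' him
  exact StrictMonoOn.eqOn_of_image_eq (β := (Fin n)ᵒᵈ) (avoids_q₁_iff.1 hπ i hi) hσ' him

/-! ### Termination of the procedure -/

theorem toLex_mul_swap_lt {π : Equiv.Perm (Fin n)} {j k : Fin n} (hjk : j < k)
    (h : π k < π j) : toLex ⇑(π * Equiv.swap j k) < toLex ⇑π := by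
  refine ⟨j, fun m hm => ?_, by simpa using h⟩
  simp [Equiv.swap_apply_of_ne_of_ne hm.ne (hm.trans hjk).ne]

theorem lt_toLex_mul_swap {π : Equiv.Perm (Fin n)} {j k : Fin n} (hjk : j < k)
    (h : π j < π k) : toLex ⇑π < toLex ⇑(π * Equiv.swap j k) := by
  refine ⟨j, fun m hm => ?_, by simpa using h⟩
  simp [Equiv.swap_apply_of_ne_of_ne hm.ne (hm.trans hjk).ne]

theorem exists_isLeftmostOccurrence {k : ℕ} {p : MeshPattern k} {π : Equiv.Perm (Fin n)}
    (h : ¬ p.Avoids π) : ∃ e, p.IsLeftmostOccurrence π e := by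
  simp only [Avoids, not_forall, not_not] at h
  obtain ⟨e, he, hmin⟩ := Set.exists_min_image {e | p.IsOccurrence π e} toLex (Set.toFinite _) h
  exact ⟨e, he, hmin⟩

/-- If the first position of an occurrence of `q₂` lay in the region of some `i`, then replacing it
by `i` would give an occurrence further left. -/
theorem IsLeftmostOccurrence.isRoot {π : Equiv.Perm (Fin n)} {e : Fin 3 → Fin n}
    (h : q₂.IsLeftmostOccurrence π e) : IsRoot π (e 0) := by
  intro i hi
  obtain ⟨h1, h2, h3, h4⟩ := isOccurrence_q₂_iff.1 h.1
  have hocc : q₂.IsOccurrence π ![i, e 1, e 2] :=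
    isOccurrence_q₂_iff.2 ⟨hi.trans h1, hi.trans h2, h3, h4⟩
  refine not_lt_of_ge (h.2 _ hocc) ⟨0, fun m hm => absurd hm (Fin.not_lt_zero m), ?_⟩
  exact hi.1

theorem exists_swapStep {π : Equiv.Perm (Fin n)} (h : ¬ q₂.Avoids π) :
    ∃ σ, SwapStep π σ ∧ SameShape π σ ∧ toLex ⇑σ < toLex ⇑π := by
  obtain ⟨e, he⟩ := exists_isLeftmostOccurrence h
  obtain ⟨h1, h2, h3, h4⟩ := isOccurrence_q₂_iff.1 he.1
  exact ⟨_, ⟨e, he, rfl⟩, SameShape.mul_swap he.isRoot h1 h2, toLex_mul_swap_lt h3 h4⟩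

/-- Induction on the word of `π` in the lexicographic order: the procedure stops at a `q₂`-avoiding
permutation of the same shape. -/
theorem exists_reflTransGen_swapStep (π : Equiv.Perm (Fin n)) :
    ∃ σ, q₂.Avoids σ ∧ Relation.ReflTransGen SwapStep π σ ∧ SameShape π σ := by
  induction π using (InvImage.wf (fun π : Equiv.Perm (Fin n) => toLex ⇑π) wellFounded_lt).induction with
  | _ π ih =>
    by_cases h : q₂.Avoids π
    · exact ⟨π, h, .refl, .refl π⟩
    · obtain ⟨τ, hstep, hshape, hlt⟩ := exists_swapStep h
      obtain ⟨σ, hσ, hreach, hshape'⟩ := ih τ hlt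
      exact ⟨σ, hσ, hreach.head hstep, hshape.trans hshape'⟩

/-- The lexicographically largest permutation of a given shape avoids `q₁`: swapping an ascent in
the region of a root would give a larger one of the same shape. -/
theorem exists_sameShape_avoids_q₁ (π : Equiv.Perm (Fin n)) :
    ∃ σ, q₁.Avoids σ ∧ SameShape π σ := by
  obtain ⟨σ, hσ, hmax⟩ := Set.exists_max_image {σ | SameShape π σ}
    (fun σ => toLex ⇑σ) (Set.toFinite _) ⟨π, .refl π⟩
  refine ⟨σ, avoids_q₁_iff.2 fun i hi j hj k hk hjk => ?_, hσ⟩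
  by_contra hc
  have hlt : σ j < σ k := lt_of_le_of_ne (not_lt.1 hc) (σ.injective.ne hjk.ne)
  exact not_lt_of_ge (hmax _ (SameShape.trans hσ (.mul_swap hi hj hk)))
    (lt_toLex_mul_swap hjk hlt)

/-! ### The bijection -/

theorem exists_equiv_reflTransGen_swapStep (n : ℕ) :
    ∃ g : {π : Equiv.Perm (Fin n) // q₁.Avoids π} ≃ {π : Equiv.Perm (Fin n) // q₂.Avoids π},
      ∀ π : {π : Equiv.Perm (Fin n) // q₁.Avoids π},
        Relation.ReflTransGen SwapStep (π : Equiv.Perm (Fin n)) (g π) := by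
  choose g hg hreach hshape using exists_reflTransGen_swapStep (n := n)
  refine ⟨Equiv.ofBijective (fun π => ⟨g π, hg π⟩) ⟨fun π σ h => ?_, fun σ => ?_⟩,
    fun π => hreach π⟩
  · have h' : g π = g σ := congrArg Subtype.val h
    exact Subtype.ext (((hshape π).trans (h' ▸ (hshape σ).symm)).eq_of_avoids_q₁ π.2 σ.2)
  · obtain ⟨π, hπ, hσπ⟩ := exists_sameShape_avoids_q₁ (σ : Equiv.Perm (Fin n))
    exact ⟨⟨π, hπ⟩, Subtype.ext ((hσπ.trans (hshape π)).symm.eq_of_avoids_q₂ (hg π) σ.2)⟩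

end MeshPattern

theorem mainTheorem4 :
    MeshPattern.WilfEquivalent MeshPattern.q₁ MeshPattern.q₂ ∧
    ∀ n : ℕ, ∃ g : {π : Equiv.Perm (Fin n) // MeshPattern.q₁.Avoids π} ≃
        {π : Equiv.Perm (Fin n) // MeshPattern.q₂.Avoids π},
      ∀ π : {π : Equiv.Perm (Fin n) // MeshPattern.q₁.Avoids π},
        Relation.ReflTransGen MeshPattern.SwapStep (π : Equiv.Perm (Fin n)) (g π) :=
  ⟨fun n => Nat.card_congr (MeshPattern.exists_equiv_reflTransGen_swapStep n).choose,
    MeshPattern.exists_equiv_reflTransGen_swapStep⟩
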